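/- Let $(G,+)$ be a locally compact, Hausdorff, second-countable Abelian topological group with its Borel $\sigma$-algebra and a fixed Haar measure $\lambda_G$. Let $\mathrm{M}(G)$ be the set of Borel measures on $G$ that are finite on compact sets, with the $\sigma$-algebra generated by the maps $\xi\mapsto\xi(K)$, $K$ compact, and let $\emptyset\in\mathrm{M}(G)$ denote the zero measure. Let $\mathrm{N}_s(G)\subset\mathrm{M}(G)$ be the set of simple counting measures, i.e. $\xi=\sum_{t\in F}\delta_t$ with $F\subset G$ locally finite (possibly finite or empty). For $t\in G$ put $\tau_t\xi=\xi(\cdot+t)$. A measure $\mathrm{P}$ on $\mathrm{M}(G)$ is *stationary* if its image under $\tau_t$ is $\mathrm{P}$ for every $t\in G$. A measure $\mathrm{P}_0$ on $\mathrm{M}(G)$ is the *Palm measure* of a $\sigma$-finite stationary measure $\mathrm{P}$ if $$\mathrm{P}_0(A)=\int_{\mathrm{M}(G)}\int_G \omega(t)\,\mathbf 1(\tau_t\xi\in A)\,\xi(\mathrm{d}t)\,\mathrm{P}(\mathrm{d}\xi)$$ for every measurable $A\subset\mathrm{M}(G)$ and every measurable $\omega:G\to[0,\infty)$ with $\int_G\omega\,\mathrm{d}\lambda_G=1$.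 Let $\mathrm{F}(G)$ be the set of continuous maps $B:G\to G$ with $B_0=0$ such that for every $\xi\in \mathrm{M}(G)$ the push-forward $\xi_B$ of $\xi$ under $t\mapsto t+B_t$ is finite on compact sets; equip $\mathrm{F}(G)$ with the $\sigma$-algebra generated by the evaluations $B\mapsto B_t$. A $\sigma$-finite measure $\nu$ on $\mathrm{F}(G)$ is *weakly stationary* if it is invariant under $B\mapsto (B_{t+s}-B_t)_{s\in G}$ for every $t\in G$, and *pointwise non-atomic* if $\nu(\{B: B_t=x\})=0$ for all $t\in G\setminus\{0\}$ and all $x\in G$. Let $\mathrm{P}_0^\nu$ be the push-forward of $\mathrm{P}_0\otimes\nu$ under $(\xi,B)\mapsto\xi_B$. **Corollary.** Let $\mathrm{P}_0$ be the Palm measure of a $\sigma$-finite stationary measure $\mathrm{P}$ on $\mathrm{M}(G)$, let $\nu$ be a $\sigma$-finite weakly stationary measure on $\mathrm{F}(G)$, and suppose that $\mathrm{P}_0^\nu$ is $\sigma$-finite. Assume moreover that $\mathrm{P}_0$ is supported on $\mathrm{N}_s(G)$, i.e. $\mathrm{P}_0(\mathrm{M}(G)\setminus \mathrm{N}_s(G))=0$,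 and that $\nu$ is pointwise non-atomic. Then there is a $\sigma$-finite stationary measure $\mathrm{P}^\nu$ on $\mathrm{M}(G)$ with $\mathrm{P}^\nu(\{\emptyset\})=0$ whose Palm measure is $\mathrm{P}_0^\nu$, and every $\sigma$-finite stationary measure $\mathrm{P}^\nu$ on $\mathrm{M}(G)$ whose Palm measure is $\mathrm{P}_0^\nu$ is supported on $\mathrm{N}_s(G)$. -/

import Mathlib

open MeasureTheory
open scoped NNReal ENNReal

namespace PalmPerturbation

/-- `M(G)`: the Borel measures on `G` that are finite on compact sets. -/
@[ext]
structure LocFinMeasure (G : Type*) [TopologicalSpace G] [MeasurableSpace G] where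
  /-- The underlying measure. -/
  toMeasure : Measure G
  lt_top_of_isCompact : ∀ K : Set G, IsCompact K → toMeasure K < ⊤

/-- The σ-algebra on `M(G)` generated by the maps `ξ ↦ ξ(K)` for `K` compact. -/
instance LocFinMeasure.instMeasurableSpace (G : Type*) [TopologicalSpace G] [MeasurableSpace G] :
    MeasurableSpace (LocFinMeasure G) :=
  ⨆ (K : Set G) (_ : IsCompact K),
    MeasurableSpace.comap (fun ξ : LocFinMeasure G => ξ.toMeasure K) (borel ℝ≥0∞)

/-- The zero measure, as a point of `M(G)`. -/
instance LocFinMeasure.instZero (G : Type*) [TopologicalSpace G] [MeasurableSpace G] :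
    Zero (LocFinMeasure G) :=
  ⟨⟨0, fun _ _ => by simp⟩⟩

/-- `ξ` is a simple counting measure: `ξ = ∑_{t ∈ F} δ_t` for a locally finite set `F`
(possibly finite or empty). -/
def LocFinMeasure.IsSimpleCounting {G : Type*} [TopologicalSpace G] [MeasurableSpace G]
    (ξ : LocFinMeasure G) : Prop :=
  ∃ F : Set G, (∀ K : Set G, IsCompact K → (F ∩ K).Finite) ∧
    ξ.toMeasure = Measure.sum (fun t : F => Measure.dirac (t : G))

/-- `F(G)`: the continuous maps `B : G → G` with `B 0 = 0` such that the push-forward of every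
locally finite measure under `t ↦ t + B t` is again locally finite. -/
structure PathSpace (G : Type*) [AddCommGroup G] [TopologicalSpace G] [MeasurableSpace G] where
  /-- The underlying map. -/
  toFun : G → G
  continuous_toFun : Continuous toFun
  map_zero : toFun 0 = 0
  lt_top_of_isCompact : ∀ (ξ : LocFinMeasure G) (K : Set G), IsCompact K →
    ξ.toMeasure ((fun t => t + toFun t) ⁻¹' K) < ⊤

/-- The cylindrical σ-algebra on `F(G)`, generated by the evaluations `B ↦ B t`. -/
instance PathSpace.instMeasurableSpace (G : Type*) [AddCommGroup G] [TopologicalSpace G]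
    [m : MeasurableSpace G] : MeasurableSpace (PathSpace G) :=
  ⨆ t : G, MeasurableSpace.comap (fun B : PathSpace G => B.toFun t) m

section

variable {G : Type*} [AddCommGroup G] [TopologicalSpace G] [IsTopologicalAddGroup G]
  [T2Space G] [SecondCountableTopology G] [MeasurableSpace G] [BorelSpace G]

/-- The translation `τ_t ξ = ξ(· + t)`, i.e. the push-forward of `ξ` under `s ↦ s - t`. -/
noncomputable def translate (t : G) (ξ : LocFinMeasure G) : LocFinMeasure G where
  toMeasure := ξ.toMeasure.map (fun s => s - t)
  lt_top_of_isCompact K hK := by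
    have hc : Continuous (fun s : G => s - t) := by fun_prop
    rw [Measure.map_apply hc.measurable hK.measurableSet]
    have h : (fun s : G => s - t) ⁻¹' K = (fun s : G => s + t) '' K := by
      ext s
      constructor
      · intro hs
        exact ⟨s - t, hs, by simp⟩
      · rintro ⟨u, hu, rfl⟩
        simpa using hu
    rw [h]
    exact ξ.lt_top_of_isCompact _ (hK.image (by fun_prop))

/-- The increment shift `(θ_t B)_s = B_{t+s} - B_t`. -/
def shift (t : G) (B : PathSpace G) : PathSpace G where
  toFun s := B.toFun (t + s) - B.toFun t
  continuous_toFun := by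
    have := B.continuous_toFun
    fun_prop
  map_zero := by simp
  lt_top_of_isCompact ξ K hK := by
    have hK' : IsCompact ((fun x : G => x + (t + B.toFun t)) '' K) := hK.image (by fun_prop)
    have h := B.lt_top_of_isCompact (translate (-t) ξ) _ hK'
    have hB := B.continuous_toFun
    have hc : Continuous (fun s : G => s - -t) := by fun_prop
    have hc' : Continuous (fun s : G => s + B.toFun s) := by fun_prop
    simp only [translate] at h
    rw [Measure.map_apply hc.measurable (hc'.measurable hK'.measurableSet)] at h
    refine lt_of_le_of_lt (measure_mono ?_) h
    intro s hs
    refine ⟨_, hs, ?_⟩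
    simp only [sub_neg_eq_add, add_comm s t]
    abel

/-- `Γ(ξ, B) = ξ_B`: the push-forward of `ξ` under `t ↦ t + B t`. -/
noncomputable def perturb (p : LocFinMeasure G × PathSpace G) : LocFinMeasure G where
  toMeasure := p.1.toMeasure.map (fun t => t + p.2.toFun t)
  lt_top_of_isCompact K hK := by
    have hB := p.2.continuous_toFun
    have hc : Continuous (fun s : G => s + p.2.toFun s) := by fun_prop
    rw [Measure.map_apply hc.measurable hK.measurableSet]
    exact p.2.lt_top_of_isCompact p.1 K hK

/-- `P` is invariant under all translations. -/
def IsStationary (P : Measure (LocFinMeasure G)) : Prop :=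
  ∀ t : G, P.map (translate t) = P

/-- `P₀` is the Palm measure of `P` relative to the Haar measure `lam`:
`P₀(A) = ∫∫ ω(t) 1(τ_t ξ ∈ A) ξ(dt) P(dξ)` for every measurable weight `ω ≥ 0` with
`∫ ω dlam = 1`. -/
def IsPalmMeasure (lam : Measure G) (P P₀ : Measure (LocFinMeasure G)) : Prop :=
  ∀ ω : G → ℝ≥0, Measurable ω → ∫⁻ t, (ω t : ℝ≥0∞) ∂lam = 1 →
    ∀ A : Set (LocFinMeasure G), MeasurableSet A →
      P₀ A = ∫⁻ ξ, ∫⁻ t, (ω t : ℝ≥0∞) * A.indicator (fun _ => (1 : ℝ≥0∞)) (translate t ξ)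
        ∂ξ.toMeasure ∂P

/-- `ν` has stationary increments. -/
def IsWeaklyStationary (ν : Measure (PathSpace G)) : Prop :=
  ∀ t : G, ν.map (shift t) = ν

/-- For every `t ≠ 0`, the image of `ν` under `B ↦ B t` has no atoms. -/
def IsPointwiseNonatomic (ν : Measure (PathSpace G)) : Prop :=
  ∀ t : G, t ≠ 0 → ∀ x : G, ν {B | B.toFun t = x} = 0

/-- `P₀^ν = Γ ∘ (P₀ ⊗ ν)`. -/
noncomputable def perturbedPalm (P₀ : Measure (LocFinMeasure G)) (ν : Measure (PathSpace G)) :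
    Measure (LocFinMeasure G) :=
  (P₀.prod ν).map perturb

end

end PalmPerturbation

/-!
A σ-finite measure `Q` on `M(G)` without mass at `0` is the Palm measure of a σ-finite stationary
measure as soon as it satisfies Mecke's identity
`∫∫ f (τ_t ξ, -t) ξ(dt) Q(dξ) = ∫∫ f (ξ, t) ξ(dt) Q(dξ)`. The existence statement therefore
reduces to transferring this identity from `P₀` to its perturbation.

* The defining relation of the Palm measure and the stationarity of `P` give the refined Campbell
  formula (`IsPalmMeasure.campbellFormula`), and from it Mecke's identity for `P₀`
  (`IsPalmMeasure.meckeIdentity`).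
* Re-rooting the perturbed measure at the perturbed position `s + B s` of `s` gives the
  perturbation of `τ_s ξ` by the increments of `B` after `s` (`translate_perturb`). As `ν` is
  invariant under passing to increments, Mecke's identity passes from `P₀` to
  `perturbedPalm P₀ ν` (`MeckeIdentity.perturbedPalm`).
* Mecke's inversion formula produces the stationary measure: with a measurable weight `h` such
  that `∫ h (ξ, t) ξ(dt) = 1` for `ξ ≠ 0`, the measure
  `P (g) = ∫∫ h (τ_{-t} ξ, t) g (τ_{-t} ξ) lam(dt) Q(dξ)` satisfies the Campbell formula with
  respect to `Q` (`campbellFormula_inversePalm`). The formula makes `P` independent of `h`, hence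
  stationary, and σ-finite along with `Q` (`exists_isPalmMeasure`).
* A locally finite `ξ` is simple counting if and only if `ξ {t} = 1` for `ξ`-almost every `t`
  (`LocFinMeasure.isSimpleCounting_iff`), so that these measures form a measurable set. Two points
  of a simple counting measure collide under the perturbation with `ν`-measure zero, because the
  increment between them has no atoms, and a simple counting measure has only countably many pairs
  of points. Thus the perturbed Palm measure is supported on simple counting measures, and the
  Campbell formula carries this over to every stationary measure it is the Palm measure of
  (`CampbellFormula.ae_isSimpleCounting`).
-/

set_option linter.unusedSectionVars false

namespace PalmPerturbation

open ProbabilityTheory Set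

/-! ### Measurability on the space of locally finite measures -/

section Measurability

variable {G : Type*} [TopologicalSpace G] [MeasurableSpace G]

instance LocFinMeasure.instIsFiniteMeasureOnCompacts (ξ : LocFinMeasure G) :
    IsFiniteMeasureOnCompacts ξ.toMeasure :=
  ⟨fun _ hK => ξ.lt_top_of_isCompact _ hK⟩

@[simp]
theorem LocFinMeasure.toMeasure_zero : (0 : LocFinMeasure G).toMeasure = 0 := rfl

theorem LocFinMeasure.measurable_apply_of_isCompact {K : Set G} (hK : IsCompact K) :
    Measurable fun ξ : LocFinMeasure G => ξ.toMeasure K :=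
  Measurable.of_comap_le (le_iSup₂_of_le K hK (by rw [BorelSpace.measurable_eq (α := ℝ≥0∞)]))

theorem LocFinMeasure.measurable_of_isCompact {α : Type*} [MeasurableSpace α]
    {X : α → LocFinMeasure G} (h : ∀ K, IsCompact K → Measurable fun a => (X a).toMeasure K) :
    Measurable X := by
  refine Measurable.of_le_map (iSup₂_le fun K hK => ?_)
  rw [← BorelSpace.measurable_eq (α := ℝ≥0∞)]
  rintro _ ⟨s, hs, rfl⟩
  exact h K hK hs

variable [T2Space G] [LocallyCompactSpace G] [SecondCountableTopology G] [BorelSpace G]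

theorem LocFinMeasure.measurable_toMeasure :
    Measurable (LocFinMeasure.toMeasure : LocFinMeasure G → Measure G) := by
  -- Restricted to a compact set the measures are finite, and closed sets are a generating π-system.
  have key : ∀ n, Measurable fun ξ : LocFinMeasure G =>
      ξ.toMeasure.restrict (compactCovering G n) := by
    intro n
    have hK := isCompact_compactCovering G n
    have : ∀ ξ : LocFinMeasure G, IsFiniteMeasure (ξ.toMeasure.restrict (compactCovering G n)) :=
      fun ξ => isFiniteMeasure_restrict.2 (ξ.lt_top_of_isCompact _ hK).ne
    refine Measurable.measure_of_isPiSystem (S := {s | IsClosed s})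
      (by rw [BorelSpace.measurable_eq (α := G), borel_eq_generateFrom_isClosed])
      isPiSystem_isClosed (fun s hs => ?_) ?_
    · simp_rw [Measure.restrict_apply (IsClosed.measurableSet hs)]
      exact measurable_apply_of_isCompact (hK.inter_left hs)
    · simp_rw [Measure.restrict_apply_univ]
      exact measurable_apply_of_isCompact hK
  refine Measure.measurable_of_measurable_coe _ fun s hs => ?_
  have h : ∀ ξ : LocFinMeasure G,
      ξ.toMeasure s = ⨆ n, ξ.toMeasure.restrict (compactCovering G n) s := by
    intro ξ
    simp_rw [Measure.restrict_apply hs]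
    rw [← Monotone.measure_iUnion, ← inter_iUnion, iUnion_compactCovering, inter_univ]
    exact fun m n hmn => inter_subset_inter_right _ (compactCovering_subset G hmn)
  simp_rw [h]
  exact Measurable.iSup fun n => (Measure.measurable_coe hs).comp (key n)

theorem LocFinMeasure.measurable_apply {s : Set G} (hs : MeasurableSet s) :
    Measurable fun ξ : LocFinMeasure G => ξ.toMeasure s :=
  (Measure.measurable_coe hs).comp measurable_toMeasure

theorem LocFinMeasure.measurableSet_singleton_zero :
    MeasurableSet ({0} : Set (LocFinMeasure G)) := by
  have : ({0} : Set (LocFinMeasure G)) = {ξ | ξ.toMeasure univ = 0} := by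
    ext ξ
    simp [LocFinMeasure.ext_iff]
  rw [this]
  exact measurable_apply MeasurableSet.univ (measurableSet_singleton 0)

variable (G) in
/-- The tautological kernel from `M(G)` to `G`, which sends `ξ` to `ξ` itself. -/
noncomputable def evalKernel : Kernel (LocFinMeasure G) G :=
  ⟨LocFinMeasure.toMeasure, LocFinMeasure.measurable_toMeasure⟩

@[simp]
theorem evalKernel_apply (ξ : LocFinMeasure G) : evalKernel G ξ = ξ.toMeasure := rfl

/-- Restricting the tautological kernel to a compact set does not make it a finite kernel, since
the mass of a compact set is not uniformly bounded in `ξ`. Therefore not only `G` is cut into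
countably many relatively compact pieces, but also `M(G)`, according to the integer part of the
mass of each piece. -/
instance evalKernel.instIsSFiniteKernel : IsSFiniteKernel (evalKernel G) := by
  classical
  set A : ℕ → Set G := disjointed (compactCovering G) with hAdef
  have hA : ∀ n, MeasurableSet (A n) := fun n =>
    MeasurableSet.disjointed (fun i => (isCompact_compactCovering G i).measurableSet) n
  have hAlt : ∀ n (ξ : LocFinMeasure G), ξ.toMeasure (A n) < ⊤ := fun n ξ =>
    (measure_mono (disjointed_subset _ n)).trans_lt
      (ξ.lt_top_of_isCompact _ (isCompact_compactCovering G n))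
  let E : ℕ → ℕ → Set (LocFinMeasure G) := fun n m => {ξ | ⌊(ξ.toMeasure (A n)).toReal⌋₊ = m}
  have hE : ∀ n m, MeasurableSet (E n m) := fun n m =>
    (Nat.measurable_floor.comp (LocFinMeasure.measurable_apply (hA n)).ennreal_toReal)
      (measurableSet_singleton m)
  let κ : ℕ × ℕ → Kernel (LocFinMeasure G) G := fun p =>
    Kernel.piecewise (hE p.1 p.2) ((evalKernel G).restrict (hA p.1)) 0
  have hfin : ∀ p, IsFiniteKernel (κ p) := by
    refine fun p => ⟨p.2 + 1, by finiteness, fun ξ => ?_⟩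
    by_cases h : ξ ∈ E p.1 p.2
    · simp only [κ, Kernel.piecewise_apply, if_pos h, Kernel.restrict_apply, evalKernel_apply,
        Measure.restrict_apply_univ]
      rw [← ENNReal.ofReal_toReal (hAlt p.1 ξ).ne]
      refine (ENNReal.ofReal_le_ofReal (Nat.lt_floor_add_one _).le).trans ?_
      rw [show ⌊(ξ.toMeasure (A p.1)).toReal⌋₊ = p.2 from h,
        ENNReal.ofReal_add (by positivity) zero_le_one]
      simp
    · simp [κ, Kernel.piecewise_apply, if_neg h]
  have hsum : evalKernel G = Kernel.sum κ := by
    refine Kernel.ext fun ξ => Measure.ext fun s hs => ?_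
    rw [Kernel.sum_apply' κ ξ hs, ENNReal.tsum_prod']
    have h1 : ∀ n, ∑' m, κ (n, m) ξ s = ξ.toMeasure (s ∩ A n) := by
      intro n
      rw [tsum_eq_single ⌊(ξ.toMeasure (A n)).toReal⌋₊]
      · have : ξ ∈ E n ⌊(ξ.toMeasure (A n)).toReal⌋₊ := rfl
        simp only [κ, Kernel.piecewise_apply, if_pos this, Kernel.restrict_apply,
          evalKernel_apply, Measure.restrict_apply hs]
      · intro m hm
        have : ξ ∉ E n m := fun h => hm h.symm
        simp [κ, Kernel.piecewise_apply, if_neg this]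
    simp_rw [h1]
    rw [← measure_iUnion, ← inter_iUnion, hAdef, iUnion_disjointed, iUnion_compactCovering,
      inter_univ, evalKernel_apply]
    · exact fun i j hij =>
        ((disjoint_disjointed (compactCovering G)) hij).mono inter_subset_right inter_subset_right
    · exact fun i => hs.inter (hA i)
  rw [hsum]
  exact Kernel.isSFiniteKernel_sum

/-- Integrals against a measurably varying locally finite measure vary measurably. -/
@[fun_prop]
theorem LocFinMeasure.measurable_lintegral {α : Type*} [MeasurableSpace α]
    {X : α → LocFinMeasure G} {f : α → G → ℝ≥0∞} (hX : Measurable X)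
    (hf : Measurable (Function.uncurry f)) :
    Measurable fun a => ∫⁻ t, f a t ∂(X a).toMeasure :=
  Measurable.lintegral_kernel_prod_right' (κ := (evalKernel G).comap X hX) hf

theorem LocFinMeasure.measurable_of_lintegral {α : Type*} [MeasurableSpace α]
    {X : α → LocFinMeasure G}
    (h : ∀ f : G → ℝ≥0∞, Measurable f → Measurable fun a => ∫⁻ t, f t ∂(X a).toMeasure) :
    Measurable X := by
  refine measurable_of_isCompact fun K hK => ?_
  simpa [lintegral_indicator_one hK.measurableSet] using
    h (K.indicator 1) (measurable_one.indicator hK.measurableSet)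

end Measurability

section Group

variable {G : Type*} [AddCommGroup G] [TopologicalSpace G] [IsTopologicalAddGroup G]
  [T2Space G] [SecondCountableTopology G] [MeasurableSpace G] [BorelSpace G]

/-! ### Translations and perturbations -/

theorem lintegral_translate (t : G) (ξ : LocFinMeasure G) {f : G → ℝ≥0∞} (hf : Measurable f) :
    ∫⁻ s, f s ∂(translate t ξ).toMeasure = ∫⁻ s, f (s - t) ∂ξ.toMeasure :=
  lintegral_map hf (by fun_prop)

theorem PathSpace.measurable_toFun (B : PathSpace G) : Measurable B.toFun :=
  B.continuous_toFun.measurable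

theorem lintegral_perturb (ξ : LocFinMeasure G) (B : PathSpace G) {f : G → ℝ≥0∞}
    (hf : Measurable f) :
    ∫⁻ s, f s ∂(perturb (ξ, B)).toMeasure = ∫⁻ s, f (s + B.toFun s) ∂ξ.toMeasure :=
  lintegral_map hf (measurable_id.add B.measurable_toFun)

theorem LocFinMeasure.ext_of_lintegral {ξ η : LocFinMeasure G}
    (h : ∀ f : G → ℝ≥0∞, Measurable f →
      ∫⁻ t, f t ∂ξ.toMeasure = ∫⁻ t, f t ∂η.toMeasure) : ξ = η :=
  LocFinMeasure.ext (Measure.ext_of_lintegral _ h)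

@[simp]
theorem translate_translate (s t : G) (ξ : LocFinMeasure G) :
    translate s (translate t ξ) = translate (s + t) ξ := by
  refine LocFinMeasure.ext_of_lintegral fun f hf => ?_
  rw [lintegral_translate _ _ hf, lintegral_translate _ _ (by fun_prop),
    lintegral_translate _ _ hf]
  simp only [sub_sub, add_comm]

@[simp]
theorem translate_zero_left (ξ : LocFinMeasure G) : translate 0 ξ = ξ := by
  refine LocFinMeasure.ext_of_lintegral fun f hf => ?_
  simp [lintegral_translate _ _ hf]

@[simp]
theorem translate_eq_zero {t : G} {ξ : LocFinMeasure G} : translate t ξ = 0 ↔ ξ = 0 := by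
  have h0 : ∀ s : G, translate s (0 : LocFinMeasure G) = 0 := fun s => by
    ext1; simp [translate]
  refine ⟨fun h => ?_, fun h => h ▸ h0 t⟩
  rw [← translate_zero_left ξ, ← neg_add_cancel t, ← translate_translate, h, h0]

theorem perturb_eq_zero {ξ : LocFinMeasure G} {B : PathSpace G} :
    perturb (ξ, B) = 0 ↔ ξ = 0 := by
  rw [LocFinMeasure.ext_iff, LocFinMeasure.ext_iff, LocFinMeasure.toMeasure_zero]
  exact Measure.map_eq_zero_iff (measurable_id.add B.measurable_toFun).aemeasurable

/-- Seen from the perturbed position of `s`, the perturbed measure is the perturbation, by the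
increments after `s`, of the original measure seen from `s`. -/
theorem translate_perturb (s : G) (ξ : LocFinMeasure G) (B : PathSpace G) :
    translate (s + B.toFun s) (perturb (ξ, B)) = perturb (translate s ξ, shift s B) := by
  refine LocFinMeasure.ext_of_lintegral fun f hf => ?_
  have := B.measurable_toFun
  have := (shift s B).measurable_toFun
  rw [lintegral_translate _ _ hf, lintegral_perturb _ _ (by fun_prop), lintegral_perturb _ _ hf,
    lintegral_translate _ _ (by fun_prop)]
  refine lintegral_congr fun t => ?_
  simp only [shift]
  congr 1
  rw [add_sub_cancel]
  abel

theorem PathSpace.measurable_eval (t : G) : Measurable fun B : PathSpace G => B.toFun t :=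
  Measurable.of_comap_le (le_iSup (fun t : G =>
    MeasurableSpace.comap (fun B : PathSpace G => B.toFun t) _) t)

theorem PathSpace.measurable_of_eval {α : Type*} [MeasurableSpace α] {X : α → PathSpace G}
    (h : ∀ t, Measurable fun a => (X a).toFun t) : Measurable X := by
  refine Measurable.of_le_map (iSup_le fun t => ?_)
  rintro _ ⟨s, hs, rfl⟩
  exact h t hs

@[fun_prop]
theorem measurable_shift (t : G) : Measurable (shift t : PathSpace G → PathSpace G) :=
  PathSpace.measurable_of_eval fun s =>
    (PathSpace.measurable_eval (t + s)).sub (PathSpace.measurable_eval t)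

variable [LocallyCompactSpace G]

/-- Joint measurability of `(B, t) ↦ B t`, a consequence of the continuity of paths. -/
@[fun_prop]
theorem PathSpace.measurable_toFun_apply {α : Type*} [MeasurableSpace α] {X : α → PathSpace G}
    {T : α → G} (hX : Measurable X) (hT : Measurable T) :
    Measurable fun a => (X a).toFun (T a) :=
  (measurable_uncurry_of_continuous_of_measurable (u := fun (t : G) (B : PathSpace G) => B.toFun t)
    (fun B => B.continuous_toFun) PathSpace.measurable_eval).comp (hT.prodMk hX)

@[fun_prop]
theorem measurable_translate {α : Type*} [MeasurableSpace α] {X : α → LocFinMeasure G}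
    {T : α → G} (hT : Measurable T) (hX : Measurable X) :
    Measurable fun a => translate (T a) (X a) := by
  refine LocFinMeasure.measurable_of_lintegral fun f hf => ?_
  simp_rw [lintegral_translate _ _ hf]
  exact LocFinMeasure.measurable_lintegral hX (by fun_prop)

@[fun_prop]
theorem measurable_perturb :
    Measurable (perturb : LocFinMeasure G × PathSpace G → LocFinMeasure G) := by
  refine LocFinMeasure.measurable_of_lintegral fun f hf => ?_
  have h : ∀ p : LocFinMeasure G × PathSpace G,
      ∫⁻ t, f t ∂(perturb p).toMeasure = ∫⁻ t, f (t + p.2.toFun t) ∂p.1.toMeasure :=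
    fun p => lintegral_perturb _ _ hf
  simp_rw [h]
  fun_prop

/-! ### Campbell's theorem and Mecke's identity -/

/-- The refined Campbell theorem, as a relation between `P` and `P₀`. It contains the definition
of the Palm measure as the case `f (ξ, t) = ω t * 𝟙_A ξ`. -/
def CampbellFormula (lam : Measure G) (P P₀ : Measure (LocFinMeasure G)) : Prop :=
  ∀ f : LocFinMeasure G × G → ℝ≥0∞, Measurable f →
    ∫⁻ ξ, ∫⁻ t, f (translate t ξ, t) ∂ξ.toMeasure ∂P = ∫⁻ ξ, ∫⁻ t, f (ξ, t) ∂lam ∂P₀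

/-- Mecke's identity, the intrinsic characterisation of Palm measures: under `Q` the measure
`ξ` is, in the mean, seen in the same way from the origin and from its other points. -/
def MeckeIdentity (Q : Measure (LocFinMeasure G)) : Prop :=
  ∀ f : LocFinMeasure G × G → ℝ≥0∞, Measurable f →
    ∫⁻ ξ, ∫⁻ t, f (translate t ξ, -t) ∂ξ.toMeasure ∂Q = ∫⁻ ξ, ∫⁻ t, f (ξ, t) ∂ξ.toMeasure ∂Q

theorem exists_nnreal_lintegral_eq_one (lam : Measure G) [lam.IsAddHaarMeasure] :
    ∃ ω : G → ℝ≥0, Measurable ω ∧ ∫⁻ t, (ω t : ℝ≥0∞) ∂lam = 1 := by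
  obtain ⟨K⟩ : Nonempty (TopologicalSpace.PositiveCompacts G) := inferInstance
  have h0 : lam K ≠ 0 := (Measure.measure_pos_of_nonempty_interior lam K.interior_nonempty).ne'
  have h1 : lam K ≠ ⊤ := K.isCompact.measure_lt_top.ne
  have hK : MeasurableSet (K : Set G) := K.isCompact.measurableSet
  refine ⟨(K : Set G).indicator fun _ => (lam K).toNNReal⁻¹, measurable_const.indicator hK, ?_⟩
  have h : ∀ t, (((K : Set G).indicator (fun _ => (lam K).toNNReal⁻¹) t : ℝ≥0) : ℝ≥0∞) =
      (K : Set G).indicator (fun _ => (lam K)⁻¹) t := by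
    intro t
    by_cases ht : t ∈ (K : Set G)
    · simp only [indicator_of_mem ht]
      rw [ENNReal.coe_inv (by simp [ENNReal.toNNReal_eq_zero_iff, h0, h1]),
        ENNReal.coe_toNNReal h1]
    · simp only [indicator_of_notMem ht, ENNReal.coe_zero]
  simp_rw [h]
  rw [lintegral_indicator_const hK, ENNReal.inv_mul_cancel h0 h1]

theorem CampbellFormula.isPalmMeasure {lam : Measure G} [SFinite lam]
    {P P₀ : Measure (LocFinMeasure G)} (h : CampbellFormula lam P P₀) :
    IsPalmMeasure lam P P₀ := by
  intro ω hω h1 A hA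
  have := h (fun p => (ω p.2 : ℝ≥0∞) * A.indicator (fun _ => (1 : ℝ≥0∞)) p.1)
    (by have : Measurable (A.indicator fun _ => (1 : ℝ≥0∞)) := measurable_const.indicator hA
        fun_prop)
  simp only at this
  rw [this]
  have h2 : ∀ ξ : LocFinMeasure G, ∫⁻ t, (ω t : ℝ≥0∞) * A.indicator (fun _ => (1 : ℝ≥0∞)) ξ ∂lam
      = A.indicator (fun _ => (1 : ℝ≥0∞)) ξ := fun ξ => by
    rw [lintegral_mul_const _ (by fun_prop), h1, one_mul]
  simp_rw [h2]
  exact (lintegral_indicator_one hA).symm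

/-- The Palm measure as an explicit image of the weighted Campbell measure. -/
theorem IsPalmMeasure.eq_map {lam : Measure G} {P P₀ : Measure (LocFinMeasure G)} [SFinite P]
    (h : IsPalmMeasure lam P P₀) {ω : G → ℝ≥0} (hω : Measurable ω)
    (h1 : ∫⁻ t, (ω t : ℝ≥0∞) ∂lam = 1) :
    P₀ = ((P ⊗ₘ evalKernel G).withDensity (fun p => (ω p.2 : ℝ≥0∞))).map
      (fun p => translate p.2 p.1) := by
  have hT : Measurable fun p : LocFinMeasure G × G => translate p.2 p.1 := by fun_prop
  ext A hA
  have hi : Measurable (A.indicator fun _ => (1 : ℝ≥0∞)) := measurable_const.indicator hA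
  rw [h ω hω h1 A hA, ← lintegral_indicator_one hA]
  refine Eq.trans ?_ (lintegral_map hi hT).symm
  rw [lintegral_withDensity_eq_lintegral_mul _ (by fun_prop) (by fun_prop)]
  simp only [Pi.mul_apply]
  rw [Measure.lintegral_compProd (by fun_prop)]
  rfl

theorem IsPalmMeasure.sfinite {lam : Measure G} [lam.IsAddHaarMeasure]
    {P P₀ : Measure (LocFinMeasure G)} [SFinite P]
    (h : IsPalmMeasure lam P P₀) : SFinite P₀ := by
  obtain ⟨ω, hω, h1⟩ := exists_nnreal_lintegral_eq_one lam
  rw [h.eq_map hω h1]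
  infer_instance

theorem IsPalmMeasure.lintegral_eq {lam : Measure G} {P P₀ : Measure (LocFinMeasure G)}
    [SFinite P] (h : IsPalmMeasure lam P P₀) {ω : G → ℝ≥0} (hω : Measurable ω)
    (h1 : ∫⁻ t, (ω t : ℝ≥0∞) ∂lam = 1) {g : LocFinMeasure G → ℝ≥0∞} (hg : Measurable g) :
    ∫⁻ ξ, g ξ ∂P₀ = ∫⁻ ξ, ∫⁻ t, ω t * g (translate t ξ) ∂ξ.toMeasure ∂P := by
  rw [h.eq_map hω h1, lintegral_map hg (by fun_prop),
    lintegral_withDensity_eq_lintegral_mul _ (by fun_prop) (by fun_prop),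
    Measure.lintegral_compProd (by fun_prop)]
  rfl

theorem IsStationary.lintegral_translate {P : Measure (LocFinMeasure G)} (hP : IsStationary P)
    (t : G) {g : LocFinMeasure G → ℝ≥0∞} (hg : Measurable g) :
    ∫⁻ ξ, g (translate t ξ) ∂P = ∫⁻ ξ, g ξ ∂P := by
  conv_rhs => rw [← hP t, lintegral_map hg (by fun_prop)]

/-- For stationary `P` the Campbell measure, transported by `(ξ, t) ↦ (translate t ξ, t)`, is
invariant under shifts of the second coordinate. -/
theorem IsStationary.lintegral_campbell_add {P : Measure (LocFinMeasure G)} (hP : IsStationary P)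
    (s : G) {f : LocFinMeasure G × G → ℝ≥0∞} (hf : Measurable f) :
    ∫⁻ ξ, ∫⁻ t, f (translate t ξ, t + s) ∂ξ.toMeasure ∂P =
      ∫⁻ ξ, ∫⁻ t, f (translate t ξ, t) ∂ξ.toMeasure ∂P := by
  rw [← hP.lintegral_translate s (by fun_prop)]
  refine lintegral_congr fun ξ => ?_
  rw [PalmPerturbation.lintegral_translate _ _ (by fun_prop)]
  simp

theorem lintegral_campbell_swap (lam : Measure G) [SFinite lam]
    (P : Measure (LocFinMeasure G)) [SFinite P]
    {f : LocFinMeasure G → G → G → ℝ≥0∞}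
    (hf : Measurable fun p : LocFinMeasure G × G × G => f p.1 p.2.1 p.2.2) :
    ∫⁻ ξ, ∫⁻ t, ∫⁻ s, f ξ t s ∂lam ∂ξ.toMeasure ∂P =
      ∫⁻ s, ∫⁻ ξ, ∫⁻ t, f ξ t s ∂ξ.toMeasure ∂P ∂lam := by
  rw [lintegral_lintegral_swap]
  · refine lintegral_congr fun ξ => lintegral_lintegral_swap (Measurable.aemeasurable ?_)
    exact hf.comp (f := fun q : G × G => (ξ, q.1, q.2)) (by fun_prop)
  · refine (LocFinMeasure.measurable_lintegral (by fun_prop) ?_).aemeasurable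
    exact hf.comp (f := fun q : (G × LocFinMeasure G) × G => (q.1.2, q.2, q.1.1)) (by fun_prop)

/-- Averaging the shift-invariance of the transported Campbell measure over the shifts turns its
second marginal into the Haar measure; no σ-finiteness of `P₀` is involved. -/
theorem IsPalmMeasure.campbellFormula {lam : Measure G} [lam.IsAddHaarMeasure]
    {P P₀ : Measure (LocFinMeasure G)} [SFinite P] (hP : IsStationary P)
    (h : IsPalmMeasure lam P P₀) : CampbellFormula lam P P₀ := by
  intro f hf
  obtain ⟨ω, hω, h1⟩ := exists_nnreal_lintegral_eq_one lam
  have h1' : ∫⁻ t, (ω (-t) : ℝ≥0∞) ∂lam = 1 := by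
    rw [lintegral_neg_eq_self (fun t => (ω t : ℝ≥0∞)), h1]
  calc ∫⁻ ξ, ∫⁻ t, f (translate t ξ, t) ∂ξ.toMeasure ∂P
      = ∫⁻ s, ω s * ∫⁻ ξ, ∫⁻ t, f (translate t ξ, t + s) ∂ξ.toMeasure ∂P ∂lam := by
        simp_rw [hP.lintegral_campbell_add _ hf]
        rw [lintegral_mul_const _ (by fun_prop), h1, one_mul]
    _ = ∫⁻ s, ∫⁻ ξ, ∫⁻ t, ω s * f (translate t ξ, t + s) ∂ξ.toMeasure ∂P ∂lam := by
        refine lintegral_congr fun s => ?_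
        rw [← lintegral_const_mul _ (by fun_prop)]
        refine lintegral_congr fun ξ => ?_
        rw [← lintegral_const_mul _ (by fun_prop)]
    _ = ∫⁻ ξ, ∫⁻ t, ∫⁻ s, ω s * f (translate t ξ, t + s) ∂lam ∂ξ.toMeasure ∂P :=
        (lintegral_campbell_swap lam P (f := fun ξ t s => ω s * f (translate t ξ, t + s))
          (by fun_prop)).symm
    _ = ∫⁻ ξ, ∫⁻ t, ∫⁻ r, ω (r - t) * f (translate t ξ, r) ∂lam ∂ξ.toMeasure ∂P := by
        refine lintegral_congr fun ξ => lintegral_congr fun t => ?_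
        rw [← lintegral_add_left_eq_self
          (fun r => (ω (r - t) : ℝ≥0∞) * f (translate t ξ, r)) t]
        simp
    _ = ∫⁻ r, ∫⁻ ξ, ∫⁻ t, ω (r - t) * f (translate t ξ, r) ∂ξ.toMeasure ∂P ∂lam :=
        lintegral_campbell_swap lam P (f := fun ξ t r => ω (r - t) * f (translate t ξ, r))
          (by fun_prop)
    _ = ∫⁻ r, ∫⁻ ξ, ∫⁻ t, ω (-t) * f (translate t ξ, r) ∂ξ.toMeasure ∂P ∂lam := by
        refine lintegral_congr fun r => ?_
        have := hP.lintegral_campbell_add r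
          (f := fun p => ω (r - p.2) * f (p.1, r)) (by fun_prop)
        simp only at this
        rw [← this]
        simp
    _ = ∫⁻ r, ∫⁻ ξ, f (ξ, r) ∂P₀ ∂lam := by
        refine lintegral_congr fun r => ?_
        rw [h.lintegral_eq (ω := fun t => ω (-t)) (by fun_prop) h1' (by fun_prop)]
    _ = ∫⁻ ξ, ∫⁻ t, f (ξ, t) ∂lam ∂P₀ := by
        have := h.sfinite
        exact lintegral_lintegral_swap (by fun_prop)

theorem IsPalmMeasure.meckeIdentity {lam : Measure G} [lam.IsAddHaarMeasure]
    {P P₀ : Measure (LocFinMeasure G)} [SFinite P] (hP : IsStationary P)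
    (h : IsPalmMeasure lam P P₀) : MeckeIdentity P₀ := by
  intro f hf
  obtain ⟨ω, hω, h1⟩ := exists_nnreal_lintegral_eq_one lam
  calc ∫⁻ ξ, ∫⁻ t, f (translate t ξ, -t) ∂ξ.toMeasure ∂P₀
      = ∫⁻ ξ, ∫⁻ s, ∫⁻ t, ω s * f (translate t ξ, s - t) ∂ξ.toMeasure ∂ξ.toMeasure ∂P := by
        rw [h.lintegral_eq hω h1 (by fun_prop)]
        refine lintegral_congr fun ξ => lintegral_congr fun s => ?_
        rw [lintegral_translate _ _ (by fun_prop), ← lintegral_const_mul _ (by fun_prop)]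
        simp
    _ = ∫⁻ ξ, ∫⁻ t, ∫⁻ s, ω s * f (translate t ξ, s - t) ∂ξ.toMeasure ∂ξ.toMeasure ∂P :=
        lintegral_congr fun ξ => lintegral_lintegral_swap (by fun_prop)
    _ = ∫⁻ ξ, ∫⁻ t, ∫⁻ u, ω (u + t) * f (translate t ξ, u) ∂(translate t ξ).toMeasure
          ∂ξ.toMeasure ∂P := by
        refine lintegral_congr fun ξ => lintegral_congr fun t => ?_
        rw [lintegral_translate _ _ (by fun_prop)]
        simp
    _ = ∫⁻ ξ, ∫⁻ t, ∫⁻ u, ω (u + t) * f (ξ, u) ∂ξ.toMeasure ∂lam ∂P₀ :=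
        h.campbellFormula hP (fun p => ∫⁻ u, ω (u + p.2) * f (p.1, u) ∂p.1.toMeasure)
          (by fun_prop)
    _ = ∫⁻ ξ, ∫⁻ u, ∫⁻ t, ω (u + t) * f (ξ, u) ∂lam ∂ξ.toMeasure ∂P₀ :=
        lintegral_congr fun ξ => lintegral_lintegral_swap (by fun_prop)
    _ = ∫⁻ ξ, ∫⁻ t, f (ξ, t) ∂ξ.toMeasure ∂P₀ := by
        refine lintegral_congr fun ξ => lintegral_congr fun u => ?_
        rw [lintegral_mul_const _ (by fun_prop),
          lintegral_add_left_eq_self (fun t => (ω t : ℝ≥0∞)) u, h1, one_mul]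

theorem IsPalmMeasure.apply_zero {lam : Measure G} [lam.IsAddHaarMeasure]
    {P P₀ : Measure (LocFinMeasure G)} (h : IsPalmMeasure lam P P₀) : P₀ {0} = 0 := by
  obtain ⟨ω, hω, h1⟩ := exists_nnreal_lintegral_eq_one lam
  rw [h ω hω h1 _ LocFinMeasure.measurableSet_singleton_zero]
  have h0 : ∀ ξ : LocFinMeasure G, ∫⁻ t, (ω t : ℝ≥0∞) *
      ({0} : Set (LocFinMeasure G)).indicator (fun _ => (1 : ℝ≥0∞)) (translate t ξ)
        ∂ξ.toMeasure = 0 := by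
    intro ξ
    by_cases hξ : ξ = 0
    · simp [hξ]
    · simp [indicator, hξ]
  simp_rw [h0, lintegral_zero]

/-! ### Mecke's identity under perturbation -/

theorem lintegral_perturbedPalm (P₀ : Measure (LocFinMeasure G)) (ν : Measure (PathSpace G))
    [SFinite ν] {g : LocFinMeasure G → ℝ≥0∞} (hg : Measurable g) :
    ∫⁻ ξ, g ξ ∂(perturbedPalm P₀ ν) = ∫⁻ ξ, ∫⁻ B, g (perturb (ξ, B)) ∂ν ∂P₀ := by
  rw [perturbedPalm, lintegral_map hg measurable_perturb, lintegral_prod _ (by fun_prop)]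

theorem perturbedPalm_apply_zero {P₀ : Measure (LocFinMeasure G)} (h0 : P₀ {0} = 0)
    (ν : Measure (PathSpace G)) [SFinite ν] : perturbedPalm P₀ ν {0} = 0 := by
  rw [perturbedPalm,
    Measure.map_apply measurable_perturb LocFinMeasure.measurableSet_singleton_zero]
  have : (perturb ⁻¹' {0} : Set (LocFinMeasure G × PathSpace G)) = {0} ×ˢ univ := by
    ext ⟨ξ, B⟩
    simp [perturb_eq_zero]
  rw [this, Measure.prod_prod, h0, zero_mul]

/-- Re-rooting `perturb (ξ, B)` at the perturbed position of `s` re-roots `ξ` at `s` and replaces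
`B` by its increments `B'` after `s`, for which `-(s + B s) = -s + B' (-s)`. Weak stationarity
replaces `B'` by `B`, and Mecke's identity for `P₀` finishes. -/
theorem MeckeIdentity.perturbedPalm {P₀ : Measure (LocFinMeasure G)} (h : MeckeIdentity P₀)
    {ν : Measure (PathSpace G)} [SFinite ν] (hν : IsWeaklyStationary ν) :
    MeckeIdentity (perturbedPalm P₀ ν) := by
  intro f hf
  calc ∫⁻ ξ, ∫⁻ t, f (translate t ξ, -t) ∂ξ.toMeasure ∂(PalmPerturbation.perturbedPalm P₀ ν)
      = ∫⁻ ξ, ∫⁻ B, ∫⁻ s, f (perturb (translate s ξ, shift s B), -(s + B.toFun s))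
          ∂ξ.toMeasure ∂ν ∂P₀ := by
        rw [lintegral_perturbedPalm _ _ (by fun_prop)]
        refine lintegral_congr fun ξ => lintegral_congr fun B => ?_
        rw [lintegral_perturb _ _ (by fun_prop)]
        simp_rw [translate_perturb]
    _ = ∫⁻ ξ, ∫⁻ B, ∫⁻ s, f (perturb (translate s ξ, shift s B),
          -s + (shift s B).toFun (-s)) ∂ξ.toMeasure ∂ν ∂P₀ := by
        refine lintegral_congr fun ξ => lintegral_congr fun B => lintegral_congr fun s => ?_
        have : -(s + B.toFun s) = -s + (shift s B).toFun (-s) := by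
          simp only [shift, add_neg_cancel, B.map_zero]
          abel
        rw [this]
    _ = ∫⁻ ξ, ∫⁻ s, ∫⁻ B, f (perturb (translate s ξ, shift s B),
          -s + (shift s B).toFun (-s)) ∂ν ∂ξ.toMeasure ∂P₀ := by
        refine lintegral_congr fun ξ => lintegral_lintegral_swap (Measurable.aemeasurable ?_)
        have : Measurable fun p : PathSpace G × G => shift p.2 p.1 :=
          PathSpace.measurable_of_eval fun t => by
            simp only [shift]
            fun_prop
        fun_prop
    _ = ∫⁻ ξ, ∫⁻ s, ∫⁻ B, f (perturb (translate s ξ, B), -s + B.toFun (-s)) ∂ν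
          ∂ξ.toMeasure ∂P₀ := by
        refine lintegral_congr fun ξ => lintegral_congr fun s => ?_
        have hg : Measurable fun B : PathSpace G =>
          f (perturb (translate s ξ, B), -s + B.toFun (-s)) := by fun_prop
        conv_rhs => rw [← hν s, lintegral_map hg (by fun_prop)]
    _ = ∫⁻ ξ, ∫⁻ s, ∫⁻ B, f (perturb (ξ, B), s + B.toFun s) ∂ν ∂ξ.toMeasure ∂P₀ :=
        h (fun p => ∫⁻ B, f (perturb (p.1, B), p.2 + B.toFun p.2) ∂ν) (by fun_prop)
    _ = ∫⁻ ξ, ∫⁻ B, ∫⁻ s, f (perturb (ξ, B), s + B.toFun s) ∂ξ.toMeasure ∂ν ∂P₀ :=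
        lintegral_congr fun ξ => lintegral_lintegral_swap (by fun_prop)
    _ = ∫⁻ ξ, ∫⁻ t, f (ξ, t) ∂ξ.toMeasure ∂(PalmPerturbation.perturbedPalm P₀ ν) := by
        rw [lintegral_perturbedPalm _ _ (by fun_prop)]
        refine lintegral_congr fun ξ => lintegral_congr fun B => ?_
        rw [lintegral_perturb _ _ (by fun_prop)]

/-! ### Mecke's inversion formula -/

/-- A measurable choice of a probability density with respect to each nonzero `ξ`: the uniform
density on the first set of a compact exhaustion that `ξ` charges. -/
theorem exists_measurable_lintegral_eq_one :
    ∃ h : LocFinMeasure G × G → ℝ≥0∞, Measurable h ∧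
      ∀ ξ : LocFinMeasure G, ξ ≠ 0 → ∫⁻ t, h (ξ, t) ∂ξ.toMeasure = 1 := by
  obtain ⟨K, hKc, hKU⟩ : ∃ K : ℕ → Set G, (∀ n, IsCompact (K n)) ∧ ⋃ n, K n = univ :=
    ⟨_, isCompact_compactCovering G, iUnion_compactCovering G⟩
  have hK : ∀ n, MeasurableSet (K n) := fun n => (hKc n).measurableSet
  have hex : ∀ ξ : LocFinMeasure G, ∃ n, ξ.toMeasure (K n) ≠ 0 ∨ ξ = 0 := by
    intro ξ
    by_contra! hcon
    refine (hcon 0).2 (LocFinMeasure.ext (Measure.measure_univ_eq_zero.1 ?_))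
    rw [← hKU]
    exact measure_iUnion_null fun n => (hcon n).1
  obtain ⟨N, hN, hNK⟩ : ∃ N : LocFinMeasure G → ℕ, Measurable N ∧
      ∀ ξ : LocFinMeasure G, ξ ≠ 0 → ξ.toMeasure (K (N ξ)) ≠ 0 := by
    classical
    refine ⟨fun ξ => Nat.find (hex ξ), measurable_find hex fun n => ?_,
      fun ξ hξ => (Nat.find_spec (hex ξ)).resolve_right hξ⟩
    exact ((LocFinMeasure.measurable_apply (hK n)) (measurableSet_singleton 0)).compl.union
      LocFinMeasure.measurableSet_singleton_zero
  have hF : Measurable fun p : ℕ × (LocFinMeasure G × G) =>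
      (p.2.1.toMeasure (K p.1))⁻¹ * (K p.1).indicator (fun _ => (1 : ℝ≥0∞)) p.2.2 := by
    refine measurable_from_prod_countable_right fun n => ?_
    have h1 := LocFinMeasure.measurable_apply (hK n)
    have h2 : Measurable ((K n).indicator fun _ => (1 : ℝ≥0∞)) := measurable_const.indicator (hK n)
    exact (h1.comp measurable_fst).inv.mul (h2.comp measurable_snd)
  refine ⟨fun p => (p.1.toMeasure (K (N p.1)))⁻¹ *
    (K (N p.1)).indicator (fun _ => (1 : ℝ≥0∞)) p.2,
    hF.comp (f := fun p : LocFinMeasure G × G => (N p.1, p))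
      ((hN.comp measurable_fst).prodMk measurable_id), fun ξ hξ => ?_⟩
  dsimp only
  rw [lintegral_const_mul _ (measurable_const.indicator (hK _)),
    lintegral_indicator_const (hK _), one_mul]
  exact ENNReal.inv_mul_cancel (hNK ξ hξ)
    (ξ.lt_top_of_isCompact _ (hKc _)).ne

/-- The measure reconstructed from `Q` by Mecke's inversion formula with weight `h`. -/
noncomputable def inversePalm (lam : Measure G) (Q : Measure (LocFinMeasure G))
    (h : LocFinMeasure G × G → ℝ≥0∞) : Measure (LocFinMeasure G) :=
  ((Q.prod lam).withDensity (fun p => h (translate (-p.2) p.1, p.2))).map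
    (fun p => translate (-p.2) p.1)

section Inversion

variable {lam : Measure G} [lam.IsAddHaarMeasure] {Q : Measure (LocFinMeasure G)} [SFinite Q]
  {h : LocFinMeasure G × G → ℝ≥0∞}

theorem lintegral_inversePalm (hh : Measurable h) {g : LocFinMeasure G → ℝ≥0∞}
    (hg : Measurable g) :
    ∫⁻ ξ, g ξ ∂(inversePalm lam Q h) =
      ∫⁻ ξ, ∫⁻ t, h (translate (-t) ξ, t) * g (translate (-t) ξ) ∂lam ∂Q := by
  rw [inversePalm, lintegral_map hg (by fun_prop),
    lintegral_withDensity_eq_lintegral_mul _ (by fun_prop) (by fun_prop),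
    lintegral_prod _ (by fun_prop)]
  rfl

theorem inversePalm_apply_zero (hh : Measurable h) (h0 : Q {0} = 0) :
    inversePalm lam Q h {0} = 0 := by
  have hi : Measurable (({0} : Set (LocFinMeasure G)).indicator fun _ => (1 : ℝ≥0∞)) :=
    measurable_const.indicator LocFinMeasure.measurableSet_singleton_zero
  refine (lintegral_indicator_one LocFinMeasure.measurableSet_singleton_zero).symm.trans
    ((lintegral_inversePalm hh hi).trans ?_)
  refine lintegral_eq_zero_of_ae_eq_zero ?_
  have : ∀ᵐ ξ ∂Q, ξ ≠ 0 := measure_eq_zero_iff_ae_notMem.1 h0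
  filter_upwards [this] with ξ hξ
  simp [indicator, hξ]

/-- Mecke's identity for `Q`, applied for each fixed shift `t`, moves the summation over the
points of the reconstructed measure onto the weight `h`, which then integrates to one. -/
theorem campbellFormula_inversePalm (hh : Measurable h)
    (hh1 : ∀ ξ : LocFinMeasure G, ξ ≠ 0 → ∫⁻ t, h (ξ, t) ∂ξ.toMeasure = 1)
    (hQ : MeckeIdentity Q) (h0 : Q {0} = 0) : CampbellFormula lam (inversePalm lam Q h) Q := by
  intro f hf
  calc ∫⁻ ξ, ∫⁻ t, f (translate t ξ, t) ∂ξ.toMeasure ∂(inversePalm lam Q h)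
      = ∫⁻ ξ, ∫⁻ t, ∫⁻ u, h (translate (-t) ξ, t) * f (translate u ξ, u + t)
          ∂ξ.toMeasure ∂lam ∂Q := by
        rw [lintegral_inversePalm hh (by fun_prop)]
        refine lintegral_congr fun ξ => lintegral_congr fun t => ?_
        rw [lintegral_translate _ _ (by fun_prop), ← lintegral_const_mul _ (by fun_prop)]
        simp
    _ = ∫⁻ t, ∫⁻ ξ, ∫⁻ u, h (translate (-t) ξ, t) * f (translate u ξ, u + t)
          ∂ξ.toMeasure ∂Q ∂lam :=
        lintegral_lintegral_swap (Measurable.aemeasurable (by fun_prop))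
    _ = ∫⁻ t, ∫⁻ ξ, ∫⁻ u, h (translate (u - t) ξ, t) * f (ξ, t - u)
          ∂ξ.toMeasure ∂Q ∂lam := by
        refine lintegral_congr fun t => ?_
        rw [← hQ (fun p => h (translate (p.2 - t) p.1, t) * f (p.1, t - p.2)) (by fun_prop)]
        refine lintegral_congr fun ξ => lintegral_congr fun u => ?_
        simp only [translate_translate, sub_neg_eq_add, add_comm u t]
        congr 4
        abel
    _ = ∫⁻ ξ, ∫⁻ t, ∫⁻ u, h (translate (u - t) ξ, t) * f (ξ, t - u)
          ∂ξ.toMeasure ∂lam ∂Q :=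
        (lintegral_lintegral_swap (Measurable.aemeasurable (by fun_prop))).symm
    _ = ∫⁻ ξ, ∫⁻ u, ∫⁻ t, h (translate (u - t) ξ, t) * f (ξ, t - u)
          ∂lam ∂ξ.toMeasure ∂Q :=
        lintegral_congr fun ξ => lintegral_lintegral_swap (by fun_prop)
    _ = ∫⁻ ξ, ∫⁻ u, ∫⁻ r, h (translate (-r) ξ, u + r) * f (ξ, r)
          ∂lam ∂ξ.toMeasure ∂Q := by
        refine lintegral_congr fun ξ => lintegral_congr fun u => ?_
        rw [← lintegral_add_left_eq_self
          (fun t => h (translate (u - t) ξ, t) * f (ξ, t - u)) u]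
        simp
    _ = ∫⁻ ξ, ∫⁻ r, ∫⁻ u, h (translate (-r) ξ, u + r) * f (ξ, r)
          ∂ξ.toMeasure ∂lam ∂Q :=
        lintegral_congr fun ξ => lintegral_lintegral_swap (by fun_prop)
    _ = ∫⁻ ξ, ∫⁻ r, f (ξ, r) ∂lam ∂Q := by
        have : ∀ᵐ ξ ∂Q, ξ ≠ 0 := measure_eq_zero_iff_ae_notMem.1 h0
        refine lintegral_congr_ae ?_
        filter_upwards [this] with ξ hξ
        refine lintegral_congr fun r => ?_
        have h1 := hh1 (translate (-r) ξ) (by simpa using hξ)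
        rw [lintegral_translate _ _ (by fun_prop)] at h1
        simp only [sub_neg_eq_add] at h1
        rw [lintegral_mul_const _ (by fun_prop), h1, one_mul]

/-- A measure without mass at `0` is determined by its Palm measure, through the inversion formula
with an arbitrary weight `h`. -/
theorem CampbellFormula.lintegral_eq {P P₀ : Measure (LocFinMeasure G)}
    (hP : CampbellFormula lam P P₀) (hP0 : P {0} = 0) (hh : Measurable h)
    (hh1 : ∀ ξ : LocFinMeasure G, ξ ≠ 0 → ∫⁻ t, h (ξ, t) ∂ξ.toMeasure = 1)
    {g : LocFinMeasure G → ℝ≥0∞} (hg : Measurable g) :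
    ∫⁻ ξ, g ξ ∂P = ∫⁻ ξ, ∫⁻ t, h (translate (-t) ξ, t) * g (translate (-t) ξ) ∂lam ∂P₀ := by
  rw [← hP (fun p => h (translate (-p.2) p.1, p.2) * g (translate (-p.2) p.1)) (by fun_prop)]
  have : ∀ᵐ ξ ∂P, ξ ≠ 0 := measure_eq_zero_iff_ae_notMem.1 hP0
  refine lintegral_congr_ae ?_
  filter_upwards [this] with ξ hξ
  simp only [translate_translate, neg_add_cancel, translate_zero_left]
  rw [lintegral_mul_const _ (by fun_prop), hh1 ξ hξ, one_mul]

/-- Translating `P` amounts to translating the weight in the inversion formula, and the formula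
holds with every weight. -/
theorem CampbellFormula.isStationary {P P₀ : Measure (LocFinMeasure G)}
    (hP : CampbellFormula lam P P₀) (hP0 : P {0} = 0) : IsStationary P := by
  obtain ⟨h, hh, hh1⟩ := exists_measurable_lintegral_eq_one (G := G)
  intro s
  refine Measure.ext_of_lintegral _ fun g hg => ?_
  rw [lintegral_map hg (by fun_prop), hP.lintegral_eq hP0 hh hh1 hg,
    hP.lintegral_eq (h := fun p => h (translate s p.1, p.2 - s)) hP0 (by fun_prop) ?_
      (by fun_prop)]
  · refine lintegral_congr fun ξ => ?_
    rw [← lintegral_add_left_eq_self _ s]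
    simp
  · intro ξ hξ
    rw [← lintegral_translate s ξ (f := fun t => h (translate s ξ, t)) (by fun_prop)]
    exact hh1 _ (by simpa using hξ)

theorem sigmaFinite_of_lintegral_ne_top {α : Type*} [MeasurableSpace α] {μ : Measure α}
    {k : α → ℝ≥0∞} (hk : Measurable k) (hint : ∫⁻ x, k x ∂μ ≠ ⊤) (hpos : ∀ᵐ x ∂μ, k x ≠ 0) :
    SigmaFinite μ := by
  refine ⟨⟨⟨fun n => {x | ((n + 1 : ℕ) : ℝ≥0∞)⁻¹ ≤ k x} ∪ {x | k x = 0}, fun _ => trivial,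
    fun n => ?_, ?_⟩⟩⟩
  · have h0 : μ {x | k x = 0} = 0 := by simpa [ae_iff] using hpos
    refine (measure_union_le _ _).trans_lt ?_
    rw [h0, add_zero]
    exact (meas_ge_le_lintegral_div hk.aemeasurable (by simp) (by simp)).trans_lt
      (ENNReal.div_lt_top hint (by simp))
  · refine eq_univ_of_forall fun x => mem_iUnion.2 ?_
    by_cases hx : k x = 0
    · exact ⟨0, Or.inr hx⟩
    · obtain ⟨n, hn⟩ := ENNReal.exists_inv_nat_lt hx
      exact ⟨n, Or.inl (le_trans (by gcongr; exact n.le_succ) hn.le)⟩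

theorem CampbellFormula.sigmaFinite {P P₀ : Measure (LocFinMeasure G)} [SigmaFinite P₀]
    (hP : CampbellFormula lam P P₀) (hP0 : P {0} = 0) : SigmaFinite P := by
  -- Summing a strictly positive integrable `g` over the points of `ξ` gives a `P`-integrable
  -- function that vanishes only at `ξ = 0`.
  obtain ⟨g, hg0, hg, hint⟩ := exists_pos_lintegral_lt_of_sigmaFinite (P₀.prod lam) one_ne_zero
  rw [lintegral_prod _ (by fun_prop)] at hint
  have hC := hP (fun p => (g p : ℝ≥0∞)) (by fun_prop)
  refine sigmaFinite_of_lintegral_ne_top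
    (k := fun ξ => ∫⁻ t, g (translate t ξ, t) ∂ξ.toMeasure) (by fun_prop)
    (hC.trans_lt (hint.trans ENNReal.one_lt_top)).ne ?_
  have : ∀ᵐ ξ ∂P, ξ ≠ 0 := measure_eq_zero_iff_ae_notMem.1 hP0
  filter_upwards [this] with ξ hξ hk
  rw [lintegral_eq_zero_iff (by fun_prop)] at hk
  refine hξ (LocFinMeasure.ext (ae_eq_bot.1 (Filter.eventually_false_iff_eq_bot.1 ?_)))
  filter_upwards [hk] with t ht
  exact (hg0 (translate t ξ, t)).ne' (by simpa using ht)

end Inversion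

/-- Mecke's characterisation of Palm measures, existence part. -/
theorem exists_isPalmMeasure (lam : Measure G) [lam.IsAddHaarMeasure]
    {Q : Measure (LocFinMeasure G)} [SigmaFinite Q] (hQ : MeckeIdentity Q) (h0 : Q {0} = 0) :
    ∃ P : Measure (LocFinMeasure G),
      SigmaFinite P ∧ IsStationary P ∧ P {0} = 0 ∧ IsPalmMeasure lam P Q := by
  obtain ⟨h, hh, hh1⟩ := exists_measurable_lintegral_eq_one (G := G)
  have hC := campbellFormula_inversePalm (lam := lam) hh hh1 hQ h0
  have hP0 := inversePalm_apply_zero (lam := lam) hh h0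
  exact ⟨_, hC.sigmaFinite hP0, hC.isStationary hP0, hP0, hC.isPalmMeasure⟩

/-! ### Simple counting measures -/

theorem countable_of_forall_isCompact_finite_inter {F : Set G}
    (hF : ∀ K : Set G, IsCompact K → (F ∩ K).Finite) : F.Countable := by
  rw [← inter_univ F, ← iUnion_compactCovering G, inter_iUnion]
  exact countable_iUnion fun n => (hF _ (isCompact_compactCovering G n)).countable

@[fun_prop]
theorem LocFinMeasure.measurable_apply_singleton {α : Type*} [MeasurableSpace α]
    {X : α → LocFinMeasure G} {T : α → G} (hX : Measurable X) (hT : Measurable T) :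
    Measurable fun a => (X a).toMeasure {T a} := by
  have hm : MeasurableSet {p : α × G | p.2 = T p.1} :=
    measurableSet_eq_fun measurable_snd (hT.comp measurable_fst)
  have h : ∀ a, (X a).toMeasure {T a} =
      ∫⁻ s, {p : α × G | p.2 = T p.1}.indicator 1 (a, s) ∂(X a).toMeasure := by
    intro a
    rw [← lintegral_indicator_one (measurableSet_singleton (T a))]
    rfl
  simp_rw [h]
  exact measurable_lintegral hX (measurable_one.indicator hm)

theorem LocFinMeasure.ae_singleton_eq_one_of_injective {ι : Type*} [Countable ι] {x : ι → G}
    (hx : Function.Injective x) {ξ : LocFinMeasure G}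
    (h : ξ.toMeasure = Measure.sum fun i => Measure.dirac (x i)) :
    ∀ᵐ t ∂ξ.toMeasure, ξ.toMeasure {t} = 1 := by
  have h1 : ∀ i, ξ.toMeasure {x i} = 1 := by
    intro i
    rw [h, Measure.sum_apply _ (measurableSet_singleton _), tsum_eq_single i]
    · simp
    · intro j hji
      simpa using hx.ne hji
  have hm : MeasurableSet {t | ξ.toMeasure {t} = 1} :=
    (measurable_apply_singleton measurable_const measurable_id) (measurableSet_singleton 1)
  have : ∀ᵐ t ∂(Measure.sum fun i => Measure.dirac (x i)), ξ.toMeasure {t} = 1 :=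
    Measure.ae_sum_iff.2 fun i => (ae_dirac_iff hm).2 (h1 i)
  rwa [← h] at this

/-- A description of simple counting measures that is measurable in `ξ`. -/
theorem LocFinMeasure.isSimpleCounting_iff {ξ : LocFinMeasure G} :
    ξ.IsSimpleCounting ↔ ∀ᵐ t ∂ξ.toMeasure, ξ.toMeasure {t} = 1 := by
  constructor
  · rintro ⟨F, hfin, hF⟩
    have : Countable F := countable_of_forall_isCompact_finite_inter hfin
    exact ae_singleton_eq_one_of_injective Subtype.val_injective hF
  · intro h
    set F : Set G := {t | ξ.toMeasure {t} = 1} with hFdef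
    have hfin : ∀ K, IsCompact K → (F ∩ K).Finite := by
      intro K hK
      by_contra hinf
      refine (ξ.lt_top_of_isCompact K hK).ne (top_unique ?_)
      rw [← Set.Infinite.meas_eq_top hinf ⟨1, one_ne_zero, fun t ht => ht.1.ge⟩]
      exact measure_mono inter_subset_right
    have hcount : F.Countable := countable_of_forall_isCompact_finite_inter hfin
    have : Countable F := hcount
    refine ⟨F, hfin, Measure.ext fun s hs => ?_⟩
    have hsF : ξ.toMeasure s = ξ.toMeasure (⋃ t ∈ F, s ∩ {t}) := by
      rw [← inter_iUnion₂, biUnion_of_singleton]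
      exact (measure_inter_conull h).symm
    rw [hsF, measure_biUnion hcount, Measure.sum_apply _ hs]
    · refine tsum_congr fun t => ?_
      by_cases ht : (t : G) ∈ s
      · rw [inter_eq_self_of_subset_right (singleton_subset_iff.2 ht)]
        rw [show ξ.toMeasure {(t : G)} = 1 from t.2]
        simp [ht]
      · simp [ht]
    · intro t _ u _ htu
      exact (disjoint_singleton.2 htu).mono inter_subset_right inter_subset_right
    · exact fun t _ => hs.inter (measurableSet_singleton t)

theorem LocFinMeasure.measurableSet_isSimpleCounting :
    MeasurableSet {ξ : LocFinMeasure G | ξ.IsSimpleCounting} := by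
  have hm : MeasurableSet {p : LocFinMeasure G × G | p.1.toMeasure {p.2} ≠ 1} :=
    (measurable_apply_singleton measurable_fst measurable_snd) (measurableSet_singleton 1).compl
  have : {ξ : LocFinMeasure G | ξ.IsSimpleCounting} =
      {ξ | evalKernel G ξ (Prod.mk ξ ⁻¹' {p | p.1.toMeasure {p.2} ≠ 1}) = 0} := by
    ext ξ
    exact isSimpleCounting_iff
  rw [this]
  exact Kernel.measurable_kernel_prodMk_left hm (measurableSet_singleton 0)

theorem LocFinMeasure.isSimpleCounting_zero : (0 : LocFinMeasure G).IsSimpleCounting :=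
  isSimpleCounting_iff.2 (by simp)

theorem LocFinMeasure.IsSimpleCounting.translate {ξ : LocFinMeasure G} (h : ξ.IsSimpleCounting)
    (s : G) : (translate s ξ).IsSimpleCounting := by
  obtain ⟨F, hfin, hF⟩ := h
  have : Countable F := countable_of_forall_isCompact_finite_inter hfin
  refine isSimpleCounting_iff.2 (ae_singleton_eq_one_of_injective
    (x := fun t : F => (t : G) - s) (fun t u htu => Subtype.ext (sub_left_injective htu)) ?_)
  have hm : Measurable fun t : G => t - s := by fun_prop
  simp only [PalmPerturbation.translate, hF]
  rw [Measure.map_sum hm.aemeasurable]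
  simp_rw [Measure.map_dirac' hm]

/-- Two distinct points `s`, `t` collide under the perturbation only if the increment
`B t - B s`, which is distributed like `B (t - s)`, takes the value `s - t`. -/
theorem IsPointwiseNonatomic.ae_add_ne_add {ν : Measure (PathSpace G)}
    (hna : IsPointwiseNonatomic ν) (hν : IsWeaklyStationary ν) {s t : G} (hst : s ≠ t) :
    ∀ᵐ B ∂ν, s + B.toFun s ≠ t + B.toFun t := by
  have hS : MeasurableSet {B : PathSpace G | B.toFun (t - s) = s - t} :=
    (PathSpace.measurable_eval _) (measurableSet_singleton _)
  have h0 := hna (t - s) (sub_ne_zero.2 hst.symm) (s - t)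
  rw [← hν s, Measure.map_apply (by fun_prop) hS] at h0
  rw [ae_iff]
  refine measure_mono_null (fun B hB => ?_) h0
  simp only [ne_eq, not_not, mem_ofPred_eq] at hB
  simp only [shift, mem_preimage, mem_ofPred_eq, add_sub_cancel]
  rw [sub_eq_sub_iff_add_eq_add, add_comm, hB.symm, add_comm]

theorem IsPointwiseNonatomic.ae_isSimpleCounting_perturb {ν : Measure (PathSpace G)}
    (hna : IsPointwiseNonatomic ν) (hν : IsWeaklyStationary ν) {ξ : LocFinMeasure G}
    (hξ : ξ.IsSimpleCounting) : ∀ᵐ B ∂ν, (perturb (ξ, B)).IsSimpleCounting := by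
  obtain ⟨F, hfin, hF⟩ := hξ
  have : Countable F := countable_of_forall_isCompact_finite_inter hfin
  have hinj : ∀ᵐ B ∂ν, ∀ s t : F, s ≠ t → (s : G) + B.toFun s ≠ t + B.toFun t := by
    simp_rw [ae_all_iff]
    exact fun s t hst => hna.ae_add_ne_add hν (Subtype.coe_injective.ne hst)
  filter_upwards [hinj] with B hB
  refine LocFinMeasure.isSimpleCounting_iff.2 (LocFinMeasure.ae_singleton_eq_one_of_injective
    (x := fun t : F => (t : G) + B.toFun t) (fun s t hst => ?_) ?_)
  · by_contra hne
    exact hB s t hne hst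
  · have hm : Measurable fun t : G => t + B.toFun t := measurable_id.add B.measurable_toFun
    simp only [perturb, hF]
    rw [Measure.map_sum hm.aemeasurable]
    simp_rw [Measure.map_dirac' hm]

theorem ae_isSimpleCounting_perturbedPalm {P₀ : Measure (LocFinMeasure G)}
    {ν : Measure (PathSpace G)} [SFinite ν] (hna : IsPointwiseNonatomic ν)
    (hν : IsWeaklyStationary ν) (h : ∀ᵐ ξ ∂P₀, ξ.IsSimpleCounting) :
    ∀ᵐ ξ ∂(perturbedPalm P₀ ν), ξ.IsSimpleCounting := by
  have hm := LocFinMeasure.measurableSet_isSimpleCounting (G := G)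
  rw [perturbedPalm, ae_map_iff measurable_perturb.aemeasurable hm]
  refine (Measure.ae_prod_mem_iff_ae_ae_mem (measurable_perturb hm)).2 ?_
  filter_upwards [h] with ξ hξ
  exact hna.ae_isSimpleCounting_perturb hν hξ

/-- Campbell's formula gives no mass to the pairs of a non-simple `ξ` and a point of `ξ`; hence
almost every `ξ` is simple or has no points at all. -/
theorem CampbellFormula.ae_isSimpleCounting {lam : Measure G} {P P₀ : Measure (LocFinMeasure G)}
    (hP : CampbellFormula lam P P₀) (h : ∀ᵐ ξ ∂P₀, ξ.IsSimpleCounting) :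
    ∀ᵐ ξ ∂P, ξ.IsSimpleCounting := by
  set S := {ξ : LocFinMeasure G | ξ.IsSimpleCounting}
  have hS : MeasurableSet S := LocFinMeasure.measurableSet_isSimpleCounting
  have hi : Measurable (Sᶜ.indicator fun _ => (1 : ℝ≥0∞)) := measurable_const.indicator hS.compl
  have h0 : ∫⁻ ξ, ∫⁻ t, Sᶜ.indicator (fun _ => (1 : ℝ≥0∞)) (translate t ξ)
      ∂ξ.toMeasure ∂P = 0 := by
    rw [hP (fun p => Sᶜ.indicator (fun _ => (1 : ℝ≥0∞)) p.1) (by fun_prop)]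
    refine lintegral_eq_zero_of_ae_eq_zero ?_
    filter_upwards [h] with ξ hξ
    have : ξ ∉ Sᶜ := not_not.2 hξ
    simp [this]
  rw [lintegral_eq_zero_iff (by fun_prop)] at h0
  filter_upwards [h0] with ξ hξ
  by_contra hns
  have h1 : ∀ t, translate t ξ ∈ Sᶜ := by
    intro t ht
    have := LocFinMeasure.IsSimpleCounting.translate ht (-t)
    rw [translate_translate, neg_add_cancel, translate_zero_left] at this
    exact hns this
  simp only [indicator_of_mem (h1 _), lintegral_const, one_mul, Pi.zero_apply,
    Measure.measure_univ_eq_zero] at hξ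
  have : ξ = 0 := LocFinMeasure.ext hξ
  exact hns (this ▸ LocFinMeasure.isSimpleCounting_zero)

end Group

end PalmPerturbation

theorem mainTheorem4 {G : Type*} [AddCommGroup G] [TopologicalSpace G] [IsTopologicalAddGroup G]
    [T2Space G] [LocallyCompactSpace G] [SecondCountableTopology G]
    [MeasurableSpace G] [BorelSpace G]
    (lam : Measure G) [lam.IsAddHaarMeasure]
    (P P₀ : Measure (PalmPerturbation.LocFinMeasure G))
    (hPσ : SigmaFinite P) (hP : PalmPerturbation.IsStationary P)
    (hP₀ : PalmPerturbation.IsPalmMeasure lam P P₀)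
    (ν : Measure (PalmPerturbation.PathSpace G))
    (hνσ : SigmaFinite ν) (hν : PalmPerturbation.IsWeaklyStationary ν)
    (hσ : SigmaFinite (PalmPerturbation.perturbedPalm P₀ ν))
    (hsimple : ∀ᵐ ξ ∂P₀, ξ.IsSimpleCounting)
    (hna : PalmPerturbation.IsPointwiseNonatomic ν) :
    (∃ Pν : Measure (PalmPerturbation.LocFinMeasure G),
      SigmaFinite Pν ∧ PalmPerturbation.IsStationary Pν ∧ Pν {0} = 0 ∧
        PalmPerturbation.IsPalmMeasure lam Pν (PalmPerturbation.perturbedPalm P₀ ν)) ∧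
    ∀ Pν : Measure (PalmPerturbation.LocFinMeasure G),
      SigmaFinite Pν → PalmPerturbation.IsStationary Pν →
        PalmPerturbation.IsPalmMeasure lam Pν (PalmPerturbation.perturbedPalm P₀ ν) →
          ∀ᵐ ξ ∂Pν, ξ.IsSimpleCounting := by
  refine ⟨PalmPerturbation.exists_isPalmMeasure lam ((hP₀.meckeIdentity hP).perturbedPalm hν)
    (PalmPerturbation.perturbedPalm_apply_zero hP₀.apply_zero ν), fun Pν hPνσ hPν hPνQ => ?_⟩
  exact (hPνQ.campbellFormula hPν).ae_isSimpleCounting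
    (PalmPerturbation.ae_isSimpleCounting_perturbedPalm hna hν hsimple)
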